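/- Let $V$ be the complex vector space of meromorphic functions on $\mathbb{C}$ and let $A = \frac{d}{dz} : V \to V$. A function $w \in V$ is called differentially transcendental if it satisfies no algebraic differential equation, i.e. if there is no $k \ge 0$ and no nonzero polynomial $P \in \mathbb{C}[z, y_0, \dots, y_k]$ such that $P(z, w, w', \dots, w^{(k)}) = 0$ identically. Let $n \ge 1$, let $B = [b_{ij}] \in \mathbb{C}^{n \times n}$ and $\varphi_1, \dots, \varphi_n \in V$, and consider the linear system with constant coefficients $$A(x_i) = b_{i1} x_1 + \dots + b_{in} x_n + \varphi_i, \qquad 1 \le i \le n,$$ in the unknowns $x_1, \dots, x_n \in V$. Suppose that $\varphi_j$ is the only differentially transcendental one among $\varphi_1, \dots, \varphi_n$, i.e. $\varphi_j$ is differentially transcendental and $\varphi_i$ is not for every $i \ne j$. Then for every solution $(x_1, \dots, x_n) \in V^n$ of the system, the entry $x_j$ is differentially transcendental. -/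

import Mathlib

open Filter

noncomputable section

namespace MeroSystem

/-- The functions `ℂ → ℂ` that are meromorphic at every point of `ℂ`
(the values taken at the poles are arbitrary). -/
def meromorphicSubalgebra : Subalgebra ℂ (ℂ → ℂ) where
  carrier := {f | Meromorphic f}
  mul_mem' hf hg := Meromorphic.mul hf hg
  add_mem' hf hg := Meromorphic.add hf hg
  algebraMap_mem' c := Meromorphic.const c

/-- The functions that vanish outside a closed discrete set: they all represent the meromorphic
function `0`. -/
def negligible : Ideal meromorphicSubalgebra where
  carrier := {f | (f : ℂ → ℂ) =ᶠ[codiscrete ℂ] 0}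
  zero_mem' := by
    change (0 : ℂ → ℂ) =ᶠ[codiscrete ℂ] 0
    exact EventuallyEq.refl _ _
  add_mem' {f g} hf hg := by
    change f.1 + g.1 =ᶠ[codiscrete ℂ] 0
    change (f : ℂ → ℂ) =ᶠ[codiscrete ℂ] 0 at hf
    change (g : ℂ → ℂ) =ᶠ[codiscrete ℂ] 0 at hg
    filter_upwards [hf, hg] with z h₁ h₂
    simp [h₁, h₂]
  smul_mem' c f hf := by
    change c.1 * f.1 =ᶠ[codiscrete ℂ] 0
    change (f : ℂ → ℂ) =ᶠ[codiscrete ℂ] 0 at hf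
    filter_upwards [hf] with z h
    simp [h]

/-- The space `V` of meromorphic functions on `ℂ`: two everywhere-defined representatives give the
same meromorphic function iff they agree outside a closed discrete set. It is a commutative
`ℂ`-algebra, in particular a vector space over `ℂ`. -/
abbrev MeromorphicFunction : Type := meromorphicSubalgebra ⧸ negligible

/-- The meromorphic function represented by `f`. -/
def ofFun (f : ℂ → ℂ) (hf : Meromorphic f) : MeromorphicFunction :=
  Ideal.Quotient.mk negligible ⟨f, hf⟩

theorem ofFun_eq_iff {f g : ℂ → ℂ} (hf : Meromorphic f) (hg : Meromorphic g) :
    ofFun f hf = ofFun g hg ↔ f =ᶠ[codiscrete ℂ] g := by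
  unfold ofFun
  rw [Ideal.Quotient.eq]
  change f - g =ᶠ[codiscrete ℂ] 0 ↔ _
  constructor
  · intro h
    filter_upwards [h] with z hz
    simpa [sub_eq_zero] using hz
  · intro h
    filter_upwards [h] with z hz
    simp [hz]

theorem exists_ofFun (v : MeromorphicFunction) :
    ∃ (f : ℂ → ℂ) (hf : Meromorphic f), v = ofFun f hf := by
  obtain ⟨⟨f, hf⟩, rfl⟩ := Ideal.Quotient.mk_surjective v
  exact ⟨f, hf, rfl⟩

theorem ofFun_add {f g : ℂ → ℂ} (hf : Meromorphic f) (hg : Meromorphic g) :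
    ofFun f hf + ofFun g hg = ofFun (f + g) (hf.add hg) := rfl

theorem smul_ofFun (c : ℂ) {f : ℂ → ℂ} (hf : Meromorphic f) :
    c • ofFun f hf = ofFun (c • f) (hf.const_smul c) := rfl

theorem deriv_congr {f g : ℂ → ℂ} (h : f =ᶠ[codiscrete ℂ] g) :
    deriv f =ᶠ[codiscrete ℂ] deriv g := by
  have ho : IsOpen {z | f z = g z} := (mem_codiscrete'.mp h).1
  filter_upwards [h] with z hz
  exact EventuallyEq.deriv_eq (ho.mem_nhds hz)

theorem eventually_differentiableAt {f : ℂ → ℂ} (hf : Meromorphic f) :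
    ∀ᶠ z in codiscrete ℂ, DifferentiableAt ℂ f z :=
  (MeromorphicOn.eventually_codiscreteWithin_analyticAt f
    (hf.meromorphicOn (s := Set.univ))).mono fun _ h => h.differentiableAt

/-- The operator `A = d/dz` on meromorphic functions: the class of `f` is sent to the class of the
derivative of `f`. -/
def ddz : MeromorphicFunction →ₗ[ℂ] MeromorphicFunction where
  toFun v := Quotient.liftOn' v (fun f => ofFun (deriv f.1) (Meromorphic.deriv f.2)) (by
    intro f g h
    have h' : ofFun f.1 f.2 = ofFun g.1 g.2 := Quotient.sound' h
    exact (ofFun_eq_iff _ _).2 (deriv_congr ((ofFun_eq_iff _ _).1 h')))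
  map_add' v w := by
    obtain ⟨f, hf, rfl⟩ := exists_ofFun v
    obtain ⟨g, hg, rfl⟩ := exists_ofFun w
    rw [ofFun_add]
    change ofFun (deriv (f + g)) _ = ofFun (deriv f + deriv g) (hf.deriv.add hg.deriv)
    rw [ofFun_eq_iff]
    filter_upwards [eventually_differentiableAt hf, eventually_differentiableAt hg] with z h₁ h₂
    exact deriv_add h₁ h₂
  map_smul' c v := by
    obtain ⟨f, hf, rfl⟩ := exists_ofFun v
    rw [smul_ofFun]
    change ofFun (deriv (c • f)) _ =
      ofFun (c • deriv f) (hf.deriv.const_smul c)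
    rw [ofFun_eq_iff]
    filter_upwards [eventually_differentiableAt hf] with z h₁
    exact deriv_const_smul c h₁

theorem ddz_ofFun {f : ℂ → ℂ} (hf : Meromorphic f) :
    ddz (ofFun f hf) = ofFun (deriv f) hf.deriv := rfl

/-- The identity function `z`. -/
def coordZ : MeromorphicFunction := ofFun (fun z => z) fun _ => MeromorphicAt.id _

/-- `P(z, w, w', w'', …)` for a polynomial `P` over `ℂ` in the variables `z` (index `none`) and
`y₀, y₁, y₂, …` (indices `some k`). -/
def evalADE (P : MvPolynomial (Option ℕ) ℂ) (w : MeromorphicFunction) : MeromorphicFunction :=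
  MvPolynomial.aeval
    (fun i : Option ℕ => i.elim coordZ fun k => (ddz ^ k) w) P

/-- `w` is differentially transcendental if it satisfies no algebraic differential equation
`P(z, w, w', …, w⁽ᵏ⁾) = 0` with `P` a nonzero polynomial over `ℂ`. -/
def DifferentiallyTranscendental (w : MeromorphicFunction) : Prop :=
  ¬ ∃ P : MvPolynomial (Option ℕ) ℂ, P ≠ 0 ∧ evalADE P w = 0

/-- `x` solves the linear system of first order `A`-operator equations with constant coefficients
`A(xᵢ) = bᵢ₁ x₁ + … + bᵢₙ xₙ + φᵢ`, `1 ≤ i ≤ n`. -/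
def IsSolution {K V : Type*} [Field K] [AddCommGroup V] [Module K V] {n : ℕ}
    (A : V →ₗ[K] V) (B : Matrix (Fin n) (Fin n) K) (φ x : Fin n → V) : Prop :=
  ∀ i, A (x i) = ∑ k, B i k • x k + φ i

end MeroSystem

end

/-! Differential algebraicity is finiteness of transcendence degree: by
`Derivation.not_algebraicIndependent_jet_iff`, `w` is differentially algebraic iff it is algebraic
over some `F[S]` with `S` finite and `D S` algebraic over `F[S]`. Such sets `S` can be merged. If `x
j` were differentially algebraic, unite the sets belonging to `x j` and to the `φ i`, `i ≠ j`, and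
adjoin all `x i`. The system makes `D (x i)` algebraic over the resulting ring for `i ≠ j`, and `D
(x j)` is algebraic by assumption. Hence so is `φ j = D (x j) - ∑ k, B j k • x k`, a contradiction.
-/

open Algebra in
/-- A derivation that sends a set `S` to elements algebraic over `F[S]` sends all elements of `F[S]`
to such elements. -/
theorem Derivation.isAlgebraic_apply_of_mem_adjoin {F A : Type*} [Field F] [CommRing A]
    [IsDomain A] [Algebra F A] (D : Derivation F A A) {S : Set A}
    (hS : ∀ s ∈ S, IsAlgebraic (adjoin F S) (D s)) {a : A} (ha : a ∈ adjoin F S) :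
    IsAlgebraic (adjoin F S) (D a) := by
  have halg : ∀ {b : A}, b ∈ adjoin F S → IsAlgebraic (adjoin F S) b := fun {b} hb =>
    isAlgebraic_algebraMap (⟨b, hb⟩ : adjoin F S)
  induction ha using adjoin_induction with
  | mem x hx => exact hS x hx
  | algebraMap r => rw [D.map_algebraMap]; exact isAlgebraic_zero
  | add x y _ _ hx hy => rw [map_add]; exact hx.add hy
  | mul x y hx' hy' hx hy =>
    rw [D.leibniz, smul_eq_mul, smul_eq_mul]
    exact ((halg hx').mul hy).add ((halg hy').mul hx)

/-- In characteristic zero every algebraic element is a simple root of some polynomial. -/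
theorem IsAlgebraic.exists_aeval_derivative_ne_zero {R A : Type*} [CommRing R] [IsDomain R]
    [CharZero R] [CommRing A] [Algebra R A] [FaithfulSMul R A] {a : A} (ha : IsAlgebraic R a) :
    ∃ p : Polynomial R, Polynomial.aeval a p = 0 ∧ Polynomial.aeval a p.derivative ≠ 0 := by
  obtain ⟨p, hp, hpa⟩ := ha
  induction hn : p.natDegree using Nat.strong_induction_on generalizing p with
  | _ n ih =>
    by_cases h : Polynomial.aeval a p.derivative = 0
    · have hdeg : p.natDegree ≠ 0 := by
        intro h0
        rw [Polynomial.eq_C_of_natDegree_eq_zero h0, Polynomial.aeval_C,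
          FaithfulSMul.algebraMap_eq_zero_iff] at hpa
        rw [Polynomial.eq_C_of_natDegree_eq_zero h0, hpa, Polynomial.C_0] at hp
        exact hp rfl
      exact ih _ (hn ▸ Polynomial.natDegree_derivative_lt hdeg) p.derivative
        (fun h0 => hdeg (Polynomial.derivative_eq_zero.1 h0)) h rfl
    · exact ⟨p, hpa, h⟩

open Algebra in
/-- In characteristic zero, a derivation that sends a set `S` to elements algebraic over `F[S]`
preserves the set of all elements algebraic over `F[S]`. -/
theorem Derivation.isAlgebraic_apply {F A : Type*} [Field F] [CharZero F] [CommRing A]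
    [IsDomain A] [Algebra F A] (D : Derivation F A A) {S : Set A}
    (hS : ∀ s ∈ S, IsAlgebraic (adjoin F S) (D s)) {a : A} (ha : IsAlgebraic (adjoin F S) a) :
    IsAlgebraic (adjoin F S) (D a) := by
  have : CharZero (adjoin F S) := charZero_of_injective_algebraMap (R := F)
    (FaithfulSMul.algebraMap_injective F _)
  -- By the chain rule this difference is `p` with `D` applied to its coefficients, evaluated at
  -- `a`.
  have key (p : Polynomial (adjoin F S)) : IsAlgebraic (adjoin F S)
      (D (Polynomial.aeval a p) - Polynomial.aeval a p.derivative * D a) := by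
    induction p using Polynomial.induction_on' with
    | add p q hp hq =>
      convert hp.add hq using 1
      simp only [map_add]
      ring
    | monomial n r =>
      convert (D.isAlgebraic_apply_of_mem_adjoin hS r.2).mul (ha.pow n) using 1
      simp only [Polynomial.aeval_monomial, Polynomial.derivative_monomial, D.leibniz,
        D.leibniz_pow, smul_eq_mul, map_mul, nsmul_eq_mul]
      rw [_root_.map_natCast (algebraMap (adjoin F S) A) n]
      change (r : A) * _ + a ^ n * D (r : A) - (r : A) * _ * _ * _ = _
      ring
  have hpoly (p : Polynomial (adjoin F S)) : IsAlgebraic (adjoin F S) (Polynomial.aeval a p) :=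
    isAlgebraic_adjoin_singleton_iff.2 ha _ (Polynomial.aeval_mem_adjoin_singleton _ a)
  obtain ⟨p, hpa, hpa'⟩ := ha.exists_aeval_derivative_ne_zero
  refine (hpoly p.derivative).of_mul (mem_nonZeroDivisors_of_ne_zero hpa') ?_
  have h := key p
  rw [hpa, map_zero, zero_sub] at h
  simpa using h.neg

open Algebra in
/-- A family of elements algebraic over `F[S]` with `S` finite is algebraically dependent as soon as
it is infinite. -/
theorem not_algebraicIndependent_of_isAlgebraic_adjoin {F A ι : Type*} [Field F] [CommRing A]
    [IsDomain A] [Algebra F A] [Infinite ι] {S : Set A} (hS : S.Finite) {u : ι → A}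
    (hu : ∀ i, IsAlgebraic (adjoin F S) (u i)) : ¬ AlgebraicIndependent F u := by
  intro h
  -- In the matroid of algebraic independence, the closure of `S` has rank at most the cardinality
  -- of `S`.
  have hsub : Set.range u ⊆ (AlgebraicIndependent.matroid F A).closure S := by
    rw [AlgebraicIndependent.matroid_closure_eq]
    rintro _ ⟨i, rfl⟩
    exact hu i
  have hind : (AlgebraicIndependent.matroid F A).Indep (Set.range u) :=
    AlgebraicIndependent.matroid_indep_iff.2 (AlgebraicIndependent.coe_range h)
  have hle := hind.encard_le_eRk_of_subset hsub
  rw [Matroid.eRk_closure_eq] at hle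
  exact (Set.infinite_range_of_injective h.injective)
    (Set.finite_of_encard_le_coe ((hle.trans (Matroid.eRk_le_encard _ _)).trans
      hS.encard_eq_coe.le))

open Algebra in
/-- If `z` is transcendental and `z, y₀, y₁, …` are algebraically dependent, then some `yₖ` is
algebraic over `F[z, y₀, …, yₖ₋₁]`. -/
theorem exists_isAlgebraic_adjoin_of_not_algebraicIndependent {F A : Type*} [Field F]
    [CommRing A] [IsDomain A] [Algebra F A] {u : Option ℕ → A} (hz : Transcendental F (u none))
    (hu : ¬ AlgebraicIndependent F u) :
    ∃ k : ℕ, IsAlgebraic (adjoin F (u '' insert none (some '' Set.Iio k))) (u (some k)) := by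
  by_contra! hcon
  have hind (k : ℕ) : AlgebraicIndepOn F u (insert none (some '' Set.Iio k)) := by
    induction k with
    | zero =>
      have : (insert none (some '' Set.Iio 0) : Set (Option ℕ)) = {none} := by simp
      rw [this]
      exact (algebraicIndependent_singleton_iff ⟨none, rfl⟩).2 hz
    | succ k ih =>
      have : (insert none (some '' Set.Iio (k + 1)) : Set (Option ℕ)) =
          insert (some k) (insert none (some '' Set.Iio k)) := by
        rw [Set.insert_comm, ← Set.image_insert_eq, ← Order.succ_eq_add_one, Order.Iio_succ,
          Set.Iio_insert]
      rw [this]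
      exact ih.insert (hcon k)
  -- A dependence involves finitely many indices, and these lie in an initial segment.
  refine hu (algebraicIndependent_of_finite_type fun t ht => ?_)
  obtain ⟨k, hk⟩ := (ht.preimage (Option.some_injective ℕ).injOn).bddAbove
  refine (hind (k + 1)).mono ?_
  rintro (_ | i) hi
  · exact Set.mem_insert _ _
  · exact Set.mem_insert_of_mem _ ⟨i, Nat.lt_succ_of_le (hk hi), rfl⟩

section Derivation

open Algebra

variable {F A : Type*} [Field F] [CommRing A] [Algebra F A] (D : Derivation F A A)

/-- The family `z, w, D w, D (D w), …`. -/
def Derivation.jet (z w : A) (i : Option ℕ) : A :=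
  i.elim z fun k => ((D : A →ₗ[F] A) ^ k) w

theorem Derivation.apply_jet_some (z w : A) (k : ℕ) :
    D (D.jet z w (some k)) = D.jet z w (some (k + 1)) := by
  simp [Derivation.jet, pow_succ', Module.End.mul_apply]

variable [CharZero F] [IsDomain A]

/-- Applying `D` to `p(z) = 0` gives `p'(z) = 0`, which is impossible at a simple root. -/
theorem Derivation.transcendental_of_apply_eq_one {z : A} (hz : D z = 1) : Transcendental F z := by
  intro h
  obtain ⟨p, hp, hp'⟩ := h.exists_aeval_derivative_ne_zero
  have h₁ := D.map_aeval p z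
  rw [hp, map_zero, hz, smul_eq_mul, mul_one] at h₁
  exact hp' h₁.symm

/-- The family `z, w, D w, …` is algebraically dependent iff `w` is algebraic over a ring generated
by finitely many elements whose derivatives are algebraic over that ring. -/
theorem Derivation.not_algebraicIndependent_jet_iff {z : A} (hz : D z = 1) (w : A) :
    ¬ AlgebraicIndependent F (D.jet z w) ↔ ∃ S : Set A, S.Finite ∧
      (∀ s ∈ S, IsAlgebraic (adjoin F S) (D s)) ∧ IsAlgebraic (adjoin F S) w := by
  constructor
  · intro h
    obtain ⟨k, hk⟩ := exists_isAlgebraic_adjoin_of_not_algebraicIndependent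
      (D.transcendental_of_apply_eq_one hz) h
    set S := D.jet z w '' insert none (some '' Set.Iio k)
    have hle {i : ℕ} (hi : i ≤ k) : IsAlgebraic (adjoin F S) (D.jet z w (some i)) := by
      rcases hi.lt_or_eq with hi | rfl
      · exact isAlgebraic_algebraMap (⟨_, subset_adjoin
          ⟨some i, Set.mem_insert_of_mem _ ⟨i, hi, rfl⟩, rfl⟩⟩ : adjoin F S)
      · exact hk
    refine ⟨S, (((Set.finite_Iio k).image some).insert none).image _, ?_, hle (Nat.zero_le k)⟩
    rintro _ ⟨_, rfl | ⟨i, hi, rfl⟩, rfl⟩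
    · change IsAlgebraic _ (D z)
      rw [hz]
      exact isAlgebraic_one
    · rw [D.apply_jet_some]
      exact hle hi
  · rintro ⟨S, hfin, hS, hw⟩ hind
    refine not_algebraicIndependent_of_isAlgebraic_adjoin hfin
      (u := fun k => D.jet z w (some k)) (fun k => ?_)
      (hind.comp some (Option.some_injective ℕ))
    induction k with
    | zero => exact hw
    | succ k ih => rw [← D.apply_jet_some]; exact D.isAlgebraic_apply hS ih

/-- In a linear system `D xᵢ = ∑ₖ bᵢₖ xₖ + φᵢ` in which `φⱼ` is the only differentially
transcendental inhomogeneity, `xⱼ` is differentially transcendental. -/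
theorem Derivation.algebraicIndependent_jet_of_linear_system {z : A} (hz : D z = 1) {n : ℕ}
    (B : Matrix (Fin n) (Fin n) F) (φ : Fin n → A) (j : Fin n)
    (hj : AlgebraicIndependent F (D.jet z (φ j)))
    (honly : ∀ i, i ≠ j → ¬ AlgebraicIndependent F (D.jet z (φ i))) (x : Fin n → A)
    (hx : ∀ i, D (x i) = ∑ k, B i k • x k + φ i) : AlgebraicIndependent F (D.jet z (x j)) := by
  by_contra hxj
  -- At index `j`, the assumption on `x j` takes the place of the missing one on `φ j`.
  have hdata (i : Fin n) : ¬ AlgebraicIndependent F (D.jet z (if i = j then x j else φ i)) := by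
    split_ifs with h
    exacts [hxj, honly i h]
  simp_rw [D.not_algebraicIndependent_jet_iff hz] at hdata
  choose S hfin hS hmem using hdata
  let T : Set A := (⋃ i, S i) ∪ Set.range x
  have hST (i : Fin n) : S i ⊆ T := (Set.subset_iUnion S i).trans Set.subset_union_left
  have hmono {i : Fin n} {w : A} (hw : IsAlgebraic (adjoin F (S i)) w) :
      IsAlgebraic (adjoin F T) w :=
    hw.adjoin_of_forall_isAlgebraic fun _ hy => (hy.2 (hST i hy.1)).elim
  have hsum (i : Fin n) : IsAlgebraic (adjoin F T) (∑ k, B i k • x k) :=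
    isAlgebraic_algebraMap (⟨∑ k, B i k • x k, sum_mem fun k _ => (adjoin F T).smul_mem
      (subset_adjoin (Or.inr ⟨k, rfl⟩)) (B i k)⟩ : adjoin F T)
  have hDxj : IsAlgebraic (adjoin F T) (D (x j)) := by
    have h := hmem j
    rw [if_pos rfl] at h
    exact hmono (D.isAlgebraic_apply (hS j) h)
  have hT : ∀ s ∈ T, IsAlgebraic (adjoin F T) (D s) := by
    rintro s (hs | ⟨i, rfl⟩)
    · obtain ⟨i, hi⟩ := Set.mem_iUnion.1 hs
      exact hmono (hS i s hi)
    · by_cases h : i = j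
      · exact h ▸ hDxj
      · have hφ := hmem i
        rw [if_neg h] at hφ
        rw [hx i]
        exact (hsum i).add (hmono hφ)
  refine (D.not_algebraicIndependent_jet_iff hz (φ j)).2
    ⟨T, (Set.finite_iUnion hfin).union (Set.finite_range x), hT, ?_⟩ hj
  rw [← sub_eq_iff_eq_add'.2 (hx j)]
  exact hDxj.sub (hsum j)

end Derivation

/-! ### Meromorphic functions as a differential domain -/

namespace MeroSystem

theorem ofFun_mul {f g : ℂ → ℂ} (hf : Meromorphic f) (hg : Meromorphic g) :
    ofFun f hf * ofFun g hg = ofFun (f * g) (hf.mul hg) := rfl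

theorem ofFun_eq_zero_iff {f : ℂ → ℂ} (hf : Meromorphic f) :
    ofFun f hf = 0 ↔ f =ᶠ[codiscrete ℂ] 0 :=
  ofFun_eq_iff hf (Meromorphic.const 0)

/-- The identity theorem: a meromorphic function vanishes identically or almost nowhere. -/
theorem eventually_eq_zero_or_eventually_ne_zero {f : ℂ → ℂ} (hf : Meromorphic f) :
    f =ᶠ[codiscrete ℂ] 0 ∨ ∀ᶠ z in codiscrete ℂ, f z ≠ 0 := by
  by_cases h : ∀ z ∈ Set.univ, meromorphicOrderAt f z ≠ ⊤
  · exact .inr ((hf.meromorphicOn (s := Set.univ)).eventually_codiscreteWithin_apply_ne_zero h)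
  · left
    -- As the plane is connected, infinite order at one point forces infinite order everywhere.
    rw [← (hf.meromorphicOn (s := Set.univ)).exists_meromorphicOrderAt_ne_top_iff_forall_mem
      isConnected_univ] at h
    push Not at h
    simp_rw [EventuallyEq, eventually_iff, mem_codiscrete, disjoint_principal_right]
    intro z
    have hz := meromorphicOrderAt_eq_top_iff.1 (h z trivial)
    simpa [Filter.Eventually] using hz

theorem codiscrete_neBot : (codiscrete ℂ).NeBot := by
  rw [neBot_iff, ne_eq, ← empty_mem_iff_bot, mem_codiscrete]
  intro h
  exact (inferInstance : (nhdsWithin (0 : ℂ) {0}ᶜ).NeBot).ne (by simpa using h 0)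

instance : Nontrivial MeromorphicFunction := by
  refine ⟨⟨ofFun 1 (Meromorphic.const 1), 0, fun h => ?_⟩⟩
  have := codiscrete_neBot
  obtain ⟨z, hz⟩ := ((ofFun_eq_zero_iff _).1 h).exists
  exact one_ne_zero hz

instance : NoZeroDivisors MeromorphicFunction where
  eq_zero_or_eq_zero_of_mul_eq_zero {v w} h := by
    obtain ⟨f, hf, rfl⟩ := exists_ofFun v
    obtain ⟨g, hg, rfl⟩ := exists_ofFun w
    rw [ofFun_mul, ofFun_eq_zero_iff] at h
    refine or_iff_not_imp_left.2 fun hne => ?_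
    rw [ofFun_eq_zero_iff] at hne ⊢
    filter_upwards [h, (eventually_eq_zero_or_eventually_ne_zero hf).resolve_left hne] with z h₁ h₂
    exact (mul_eq_zero.1 h₁).resolve_left h₂

instance : IsDomain MeromorphicFunction := NoZeroDivisors.to_isDomain _

/-- The operator `d/dz` as a derivation. -/
noncomputable def ddzDerivation : Derivation ℂ MeromorphicFunction MeromorphicFunction :=
  Derivation.mk' ddz fun v w => by
    obtain ⟨f, hf, rfl⟩ := exists_ofFun v
    obtain ⟨g, hg, rfl⟩ := exists_ofFun w
    rw [ofFun_mul, ddz_ofFun, ddz_ofFun, ddz_ofFun, smul_eq_mul, smul_eq_mul, ofFun_mul,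
      ofFun_mul, ofFun_add, ofFun_eq_iff]
    filter_upwards [eventually_differentiableAt hf, eventually_differentiableAt hg] with z h₁ h₂
    rw [deriv_mul h₁ h₂]
    simp only [Pi.add_apply, Pi.mul_apply]
    ring

theorem ddz_coordZ : ddz coordZ = 1 := by
  change ofFun (deriv fun z => z) _ = ofFun 1 (Meromorphic.const 1)
  rw [ofFun_eq_iff, deriv_id'']
  rfl

theorem differentiallyTranscendental_iff (w : MeromorphicFunction) :
    DifferentiallyTranscendental w ↔ AlgebraicIndependent ℂ (ddzDerivation.jet coordZ w) := by
  rw [algebraicIndependent_iff, DifferentiallyTranscendental, not_exists]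
  exact forall_congr' fun P => by
    rw [not_and, not_imp_comm, not_not]
    rfl

theorem ddzDerivation_coordZ : ddzDerivation coordZ = 1 := ddz_coordZ

end MeroSystem

theorem mainTheorem6 (n : ℕ) (B : Matrix (Fin n) (Fin n) ℂ)
    (φ : Fin n → MeroSystem.MeromorphicFunction) (j : Fin n)
    (hj : MeroSystem.DifferentiallyTranscendental (φ j))
    (honly : ∀ i, i ≠ j → ¬ MeroSystem.DifferentiallyTranscendental (φ i))
    (x : Fin n → MeroSystem.MeromorphicFunction)
    (hx : MeroSystem.IsSolution MeroSystem.ddz B φ x) :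
    MeroSystem.DifferentiallyTranscendental (x j) := by
  have honly' : ∀ i, i ≠ j → ¬ AlgebraicIndependent ℂ
      (MeroSystem.ddzDerivation.jet MeroSystem.coordZ (φ i)) := fun i hi h =>
    honly i hi ((MeroSystem.differentiallyTranscendental_iff (φ i)).2 h)
  have h := @Derivation.algebraicIndependent_jet_of_linear_system ℂ MeroSystem.MeromorphicFunction
    _ _ _ MeroSystem.ddzDerivation _ _ MeroSystem.coordZ MeroSystem.ddzDerivation_coordZ n B φ j
  exact (MeroSystem.differentiallyTranscendental_iff (x j)).2
    (h ((MeroSystem.differentiallyTranscendental_iff (φ j)).1 hj) honly' x hx)
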